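/- **Model.** An instance $\mathcal I$ of Pandora Over Time consists of $n$ boxes and a time horizon $H\ge n+\sum_{i} p_i$. Each box $i\in[n]$ has a processing time $p_i\in\mathbb N$, inspection costs $\bar c_i(t)\ge 0$ for $t\in[H]$, laws $D_{it}$ on $[0,\infty)$ of finite mean for $t\in[H]$, and a (measurable) value discounting function $\bar v_i:\mathbb R_{\ge0}\times\mathbb N\to\mathbb R_{\ge0}$ with $\bar v_i(x,\tau)\le\bar v_i(x,0)=x$ for all $x,\tau$. The rewards $V_{it}\sim D_{it}$ are independent. In each of the rounds $1,\dots,H$ a strategy $\pi$ may inspect a box that it has not inspected before or stay idle, and it may halt; the round in which it halts is denoted by $T_\pi$. Inspecting $i$ at round $t$ costs $\bar c_i(t)$ and reveals $V_{it}$; the next inspection then takes place at round $t+1+p_i$ or later, and nothing is inspected after round $T_\pi$ (halting in the round of an inspection is allowed). What is done at round $t$ depends (measurably) only on the rewards revealed so far and on internal randomness of the strategy that is independent of the rewards. If $S(\pi)$ is the set of inspected boxes and $t_i(\pi)$ the round at which $i\in S(\pi)$ is inspected, the utility is $$u_{\mathcal I}(\pi)=\max_{i\in S(\pi)}\bar v_i\bigl(V_{it_i(\pi)},T_\pi-t_i(\pi)\bigr)-\sum_{i\in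 S(\pi)}\bar c_i(t_i(\pi)),$$ where here and below a maximum over the empty set is $0$. **Hypergraph.** The block bipartite hypergraph $\mathcal H(\mathcal I)$ has vertices $b_1,\dots,b_n$ and $t_1,\dots,t_H$, and one hyperedge $e(i,j)=\{b_i\}\cup\{t_k: j\le k\le \min(j+p_i,H)\}$ for each $(i,j)\in[n]\times[H]$. Let $\mathcal M(\mathcal I)$ be the set of its matchings, i.e. of all sets (including the empty one) of pairwise disjoint hyperedges. **Reservation values.** For $(i,j)\in[n]\times[H]$ let $r_{(i,j)}$ be a solution of $\mathbb E[(V_{ij}-r_{(i,j)})^+]=\bar c_i(j)$; it is a unique real number if $\bar c_i(j)>0$, and if $\bar c_i(j)=0$ any solution in $\mathbb R\cup\{+\infty\}$ is allowed (with $(V_{ij}-\infty)^+=0$). Put $Y(e(i,j))=\min\{V_{ij},r_{(i,j)}\}$. **Lemma.** For every instance $\mathcal I$ of Pandora Over Time the utility of every strategy is integrable, the expected utilities of all strategies are bounded above, and the optimal expected utility satisfies $$\sup_{\pi}\ \mathbb E\bigl[u_{\mathcal I}(\pi)\bigr]\ \le\ 2\cdot\max_{M\in\mathcal M(\mathcal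 I)}\ \mathbb E\Bigl[\max_{e(i,j)\in M}Y(e(i,j))\Bigr].$$ In particular $\mathbb E[u_{\mathcal I}(\pi^*)]$ is at most the right-hand side for every optimal strategy $\pi^*$. -/

import Mathlib

open MeasureTheory
open scoped NNReal

noncomputable section

/-- The maximum of `f` over the finite set `s`, with the convention that the maximum over the
empty set is `0`. -/
def maxOrZero {ι : Type*} (s : Finset ι) (f : ι → ℝ) : ℝ :=
  if h : s.Nonempty then s.sup' h f else 0

/-- `r` is a reservation value of a box with reward law `D` and inspection cost `c`, that is, a
solution of `E[(V - r)^+] = c` for `V ∼ D`. For `c > 0` and a reward of finite mean there is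
exactly one such `r`, and it is real. For `c = 0` every real `r` with `V ≤ r` almost surely is a
solution, and so is `r = +∞`, for which `(V - r)^+` is read as `0`. -/
def IsReservationValue (D : ProbabilityMeasure ℝ≥0) (c : ℝ≥0) (r : EReal) : Prop :=
  (∃ ρ : ℝ, r = (ρ : EReal) ∧ ∫ v : ℝ≥0, max ((v : ℝ) - ρ) 0 ∂(D : Measure ℝ≥0) = (c : ℝ)) ∨
    (r = ⊤ ∧ c = 0)

/-- The capped reward `min (v, r)`; it is a real number whenever `r ≠ -∞`. -/
def cappedReward (r : EReal) (v : ℝ≥0) : ℝ :=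
  (min (((v : ℝ) : EReal)) r).toReal

/-- An instance of Pandora Over Time with `n` boxes and time horizon `H`. The rounds `1, …, H` are
represented by `Fin H`, so `j : Fin H` stands for round `j + 1`. -/
structure PandoraOverTime (n H : ℕ) where
  /-- the cost of inspecting a box at a given round -/
  cost : Fin n → Fin H → ℝ≥0
  /-- the processing times -/
  proc : Fin n → ℕ
  /-- the law of the reward of a box that is inspected at a given round -/
  rewardLaw : Fin n → Fin H → ProbabilityMeasure ℝ≥0
  /-- the value discounting functions: sampled reward, rounds elapsed since the inspection -/
  discount : Fin n → ℝ≥0 → ℕ → ℝ≥0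
  horizon_ge : n + ∑ i, proc i ≤ H
  integrable_reward : ∀ i t, Integrable (fun v : ℝ≥0 => (v : ℝ)) (rewardLaw i t : Measure ℝ≥0)
  measurable_discount : ∀ i k, Measurable fun v => discount i v k
  discount_zero : ∀ i v, discount i v 0 = v
  discount_le : ∀ i v k, discount i v k ≤ discount i v 0

/-- A matching of a hypergraph: a set of pairwise disjoint hyperedges. -/
def IsHypergraphMatching {α : Type*} (G : Hypergraph α) (M : Set (Set α)) : Prop :=
  M ⊆ G.edgeSet ∧ M.PairwiseDisjoint id

namespace PandoraOverTime

variable {n H : ℕ}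

/-- A realization of all the rewards: one value for every box and every round. -/
abbrev Realization (n H : ℕ) : Type := Fin n × Fin H → ℝ≥0

/-- The joint law of the rewards, which are independent. -/
def realizationLaw (I : PandoraOverTime n H) : Measure (Realization n H) :=
  Measure.pi fun b => (I.rewardLaw b.1 b.2 : Measure ℝ≥0)

/-- An adaptive, possibly randomized strategy. Its internal randomness is a seed in `[0, 1]`.
For a seed `u` and a realization `ω`, `inspect u ω t` is the box inspected at round `t` (`none` if
the strategy is idle or has halted) and `halt u ω` is the round at which the strategy halts,
numbered as in `Fin H`. It may halt in the same round in which it inspects a box. -/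
structure Strategy (I : PandoraOverTime n H) where
  inspect : unitInterval → Realization n H → Fin H → Option (Fin n)
  halt : unitInterval → Realization n H → ℕ
  measurableSet_inspect : ∀ t i,
    MeasurableSet {q : unitInterval × Realization n H | inspect q.1 q.2 t = some i}
  measurable_halt : Measurable fun q : unitInterval × Realization n H => halt q.1 q.2
  /-- What is done at round `t` depends only on the seed and on the rewards revealed by the
  inspections before round `t`. -/
  inspect_adapted : ∀ u ω ω' t,
    (∀ s < t, ∀ i, inspect u ω s = some i → ω (i, s) = ω' (i, s)) →
      inspect u ω t = inspect u ω' t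
  /-- Whether the strategy halts at round `t` depends only on the seed and on the rewards revealed
  by the inspections up to and including round `t`. -/
  halt_adapted : ∀ u ω ω' (t : ℕ),
    (∀ s : Fin H, (s : ℕ) ≤ t → ∀ i, inspect u ω s = some i → ω (i, s) = ω' (i, s)) →
      halt u ω = t → halt u ω' = t
  /-- No inspection takes place after the strategy has halted. -/
  le_halt : ∀ u ω (s : Fin H) i, inspect u ω s = some i → (s : ℕ) ≤ halt u ω
  /-- No box is inspected twice. -/
  inspect_once : ∀ u ω s s' i, inspect u ω s = some i → inspect u ω s' = some i → s = s'
  /-- After the inspection of `i` at round `s`, the next inspection is not before round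
  `s + 1 + p_i`. -/
  processing : ∀ u ω (s s' : Fin H) i j, inspect u ω s = some i → inspect u ω s' = some j →
    s < s' → (s : ℕ) + 1 + I.proc i ≤ (s' : ℕ)

/-- The strategy that halts at once, so that strategies exist. -/
instance (I : PandoraOverTime n H) : Nonempty I.Strategy :=
  ⟨{ inspect := fun _ _ _ => none
     halt := fun _ _ => 0
     measurableSet_inspect := by simp
     measurable_halt := measurable_const
     inspect_adapted := fun _ _ _ _ _ => rfl
     halt_adapted := fun _ _ _ _ _ h => h
     le_halt := by simp
     inspect_once := by simp
     processing := by simp }⟩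

/-- The inspected boxes, each with its round of inspection. -/
def Strategy.inspected {I : PandoraOverTime n H} (π : I.Strategy) (u : unitInterval)
    (ω : Realization n H) : Finset (Fin n × Fin H) :=
  Finset.univ.filter fun b => π.inspect u ω b.2 = some b.1

/-- The utility of a strategy: the best discounted reward available at the round at which it
halts, minus the costs of all its inspections. -/
def utility (I : PandoraOverTime n H) (π : I.Strategy) (q : unitInterval × Realization n H) : ℝ :=
  maxOrZero (π.inspected q.1 q.2)
      (fun b => (I.discount b.1 (q.2 b) (π.halt q.1 q.2 - (b.2 : ℕ)) : ℝ)) -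
    ∑ b ∈ π.inspected q.1 q.2, (I.cost b.1 b.2 : ℝ)

/-- The expectation of the utility over the seed, which is uniform, and the rewards. -/
def expectedUtility (I : PandoraOverTime n H) (π : I.Strategy) : ℝ :=
  ∫ q, I.utility π q ∂((volume : Measure unitInterval).prod I.realizationLaw)

/-- The optimal expected utility. -/
def optimalUtility (I : PandoraOverTime n H) : ℝ :=
  ⨆ π : I.Strategy, I.expectedUtility π

/-- The hyperedge `e(i, j)` of the block bipartite hypergraph of the instance. The vertices are the
boxes (`Sum.inl`) and the rounds (`Sum.inr`), and `e(i, j)` consists of the box `i` and of those of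
the rounds `j, …, j + p_i` that do not exceed the horizon. -/
def hyperedge (I : PandoraOverTime n H) (b : Fin n × Fin H) : Set (Fin n ⊕ Fin H) :=
  {Sum.inl b.1} ∪ Sum.inr '' {k : Fin H | b.2 ≤ k ∧ (k : ℕ) ≤ (b.2 : ℕ) + I.proc b.1}

/-- Different pairs `(i, j)` give different hyperedges, so that sets of hyperedges may be
represented by sets of pairs. -/
theorem hyperedge_injective (I : PandoraOverTime n H) : Function.Injective I.hyperedge := by
  rintro ⟨i, j⟩ ⟨i', j'⟩ h
  have h1 : Sum.inl i ∈ I.hyperedge (i', j') := by rw [← h]; simp [hyperedge]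
  have h2 : Sum.inr j ∈ I.hyperedge (i', j') := by rw [← h]; simp [hyperedge]
  have h3 : Sum.inr j' ∈ I.hyperedge (i, j) := by rw [h]; simp [hyperedge]
  simp [hyperedge] at h1 h2 h3
  exact Prod.ext h1 (le_antisymm h3.1 h2.1)

/-- The block bipartite hypergraph associated with the instance. -/
def hypergraph (I : PandoraOverTime n H) : Hypergraph (Fin n ⊕ Fin H) where
  vertexSet := Set.univ
  edgeSet := Set.range I.hyperedge
  subset_vertexSet_of_mem_edgeSet' := fun _ _ => Set.subset_univ _

/-- The hyperedges `e(i, j)` with `(i, j) ∈ M` form a matching: they are pairwise disjoint. -/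
def IsMatching (I : PandoraOverTime n H) (M : Finset (Fin n × Fin H)) : Prop :=
  IsHypergraphMatching I.hypergraph (I.hyperedge '' (M : Set (Fin n × Fin H)))

/-- Since `e` is injective, disjointness may be checked on pairs. -/
theorem isMatching_iff (I : PandoraOverTime n H) (M : Finset (Fin n × Fin H)) :
    I.IsMatching M ↔ (M : Set (Fin n × Fin H)).PairwiseDisjoint I.hyperedge := by
  have h := (I.hyperedge_injective.injOn (s := (M : Set (Fin n × Fin H)))).pairwiseDisjoint_image
    (f := id)
  simp only [Function.id_comp] at h
  rw [← h, IsMatching, IsHypergraphMatching, and_iff_right]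
  exact Set.image_subset_range _ _

open Classical in
/-- The finite set of all matchings. -/
def matchings (I : PandoraOverTime n H) : Finset (Finset (Fin n × Fin H)) :=
  Finset.univ.filter I.IsMatching

theorem matchings_nonempty (I : PandoraOverTime n H) : I.matchings.Nonempty :=
  ⟨∅, by simp [matchings, isMatching_iff]⟩

/-- `E[max_{e ∈ M} Y(e)]`, where `Y(e(i, j)) = min (V_{ij}, r_{ij})`. -/
def matchingValue (I : PandoraOverTime n H) (r : Fin n → Fin H → EReal)
    (M : Finset (Fin n × Fin H)) : ℝ :=
  ∫ ω, maxOrZero M (fun b => cappedReward (r b.1 b.2) (ω b)) ∂I.realizationLaw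

/-- The maximum of `E[max_{e ∈ M} Y(e)]` over all matchings `M`. -/
def maxMatchingValue (I : PandoraOverTime n H) (r : Fin n → Fin H → EReal) : ℝ :=
  I.matchings.sup' I.matchings_nonempty (I.matchingValue r)

end PandoraOverTime

end

/-! Two estimates give the factor 2. First, whether b = (i, j) is inspected is settled before `V_b`
is seen, so its cost may be charged as the excess `V_b - Y_b ≥ 0`, whose mean is the cost
(`integral_ite_cost`). Discounting only lowers rewards, and the excess of any one inspected pair is
covered by the sum of all inspected excesses. Hence the expected utility is at most the expectation
of the largest positive part of `Y` over the inspected set S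
(`expectedUtility_le_integral_cappedUtility`). Second, for a fixed seed, compare the rewards ω with
an independent copy ω' evaluated on the same set S(ω). Let Z be the running maximum of both copies
and B that of ω' alone. When b is selected, Z grows by at most `(y_b(ω) - Z)⁺ + (y_b(ω') - Z)⁺`. The
two terms have equal mean, since neither Z nor the selection has seen coordinate b, and B ≤ Z bounds
each by the mean growth of B. Summing over time gives `lintegral_adaptive_sup_le`. Once ω is fixed,
S(ω) is a fixed matching (`isMatching_inspected`), so ω' contributes at most the best matching value
(`lintegral_sup_cappedReward_le`). -/

/-! ### Adaptivity gap for maxima over product measures. -/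

section AdaptivityGap

open Function
open scoped ENNReal

variable {β X : Type*} [Fintype β] [MeasurableSpace X]
  {μ : β → Measure X} [∀ b, IsProbabilityMeasure (μ b)]

/-- Resampling one coordinate does not change an integral with respect to a product measure. -/
theorem lintegral_pi_eq_lintegral_update [DecidableEq β] (b : β) {f : (β → X) → ℝ≥0∞} (hf : Measurable f) :
    ∫⁻ ω, f ω ∂Measure.pi μ = ∫⁻ ω, ∫⁻ v, f (update ω b v) ∂μ b ∂Measure.pi μ := by
  have hg : Measurable fun ω : β → X => ∫⁻ v, f (update ω b v) ∂μ b := by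
    rw [← lmarginal_singleton f b]
    exact hf.lmarginal μ
  refine lintegral_eq_of_lmarginal_eq {b} hf hg ?_
  simp only [lmarginal_singleton, update_idem, lintegral_const, measure_univ, mul_one]

/-- The largest of the values `w b` over those `b` before time `t` whose event contains `ω`. -/
noncomputable def supBefore {Ω : Type*} (time : β → ℕ) (E : β → Set Ω) (t : ℕ) (ω : Ω) (w : β → ℝ≥0∞) : ℝ≥0∞ :=
  Finset.univ.sup fun b => if time b < t then (E b).indicator (fun _ => w b) ω else 0

variable {time : β → ℕ} {E : β → Set (β → X)} {y : β → X → ℝ≥0∞}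

section

variable {Ω : Type*} {F : β → Set Ω}

theorem le_supBefore {b : β} {t : ℕ} (hb : time b < t) {ω : Ω} (hω : ω ∈ F b) (w : β → ℝ≥0∞) :
    w b ≤ supBefore time F t ω w := by
  refine le_trans ?_ (Finset.le_sup (Finset.mem_univ b))
  simp [hb, hω]

theorem supBefore_le {t : ℕ} {ω : Ω} {w : β → ℝ≥0∞} {a : ℝ≥0∞}
    (h : ∀ b, time b < t → ω ∈ F b → w b ≤ a) : supBefore time F t ω w ≤ a := by
  refine Finset.sup_le fun b _ => ?_
  split_ifs with hb
  · by_cases hω : ω ∈ F b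
    · simpa [hω] using h b hb hω
    · simp [hω]
  · exact zero_le

theorem supBefore_mono {t : ℕ} {ω : Ω} {w w' : β → ℝ≥0∞} (h : w ≤ w') :
    supBefore time F t ω w ≤ supBefore time F t ω w' :=
  supBefore_le fun b hb hω => (h b).trans (le_supBefore hb hω w')

theorem supBefore_congr {t : ℕ} {ω ω' : Ω} {w w' : β → ℝ≥0∞}
    (hF : ∀ b, time b < t → (ω ∈ F b ↔ ω' ∈ F b)) (hw : ∀ b, time b < t → w b = w' b) :
    supBefore time F t ω w = supBefore time F t ω' w' := by
  refine le_antisymm (supBefore_le fun b hb hω => ?_) (supBefore_le fun b hb hω => ?_)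
  · rw [hw b hb]
    exact le_supBefore hb ((hF b hb).1 hω) w'
  · rw [← hw b hb]
    exact le_supBefore hb ((hF b hb).2 hω) w

/-- The larger of two values exceeds z by at most the sum of their truncated excesses over z.
Summing over all candidates at time t only weakens the bound, so no disjointness is needed here. -/
theorem supBefore_succ_max_le (t : ℕ) (ω : Ω) (w w' : β → ℝ≥0∞) :
    supBefore time F (t + 1) ω (w ⊔ w') ≤ supBefore time F t ω (w ⊔ w') +
      ∑ b with time b = t, ((F b).indicator (fun _ => w b - supBefore time F t ω (w ⊔ w')) ω +
        (F b).indicator (fun _ => w' b - supBefore time F t ω (w ⊔ w')) ω) := by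
  set z := supBefore time F t ω (w ⊔ w') with hz
  refine supBefore_le fun b hb hω => ?_
  rcases Nat.lt_succ_iff_lt_or_eq.1 hb with h | h
  · exact (le_supBefore h hω _).trans le_self_add
  · have h1 := Finset.single_le_sum (f := fun b => (F b).indicator (fun _ => w b - z) ω +
      (F b).indicator (fun _ => w' b - z) ω) (s := Finset.univ.filter fun b => time b = t)
      (fun _ _ => zero_le) (Finset.mem_filter.2 ⟨Finset.mem_univ b, h⟩)
    refine le_trans ?_ (add_le_add_right h1 z)
    simp only [Set.indicator_of_mem hω]
    refine sup_le ?_ ?_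
    · exact le_add_tsub.trans (add_le_add_right le_self_add z)
    · exact le_add_tsub.trans (add_le_add_right le_add_self z)

/-- Disjointness leaves at most one nonzero term in the sum, and adding a truncated excess to the
running maximum gives the new maximum. -/
theorem supBefore_add_le_succ (hF : ∀ b b', b ≠ b' → time b = time b' → Disjoint (F b) (F b'))
    (t : ℕ) (ω : Ω) (w : β → ℝ≥0∞) :
    supBefore time F t ω w +
      ∑ b with time b = t, (F b).indicator (fun _ => w b - supBefore time F t ω w) ω ≤
      supBefore time F (t + 1) ω w := by
  have hle : supBefore time F t ω w ≤ supBefore time F (t + 1) ω w :=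
    supBefore_le fun b hb hω => le_supBefore (Nat.lt_succ_of_lt hb) hω w
  by_cases h : ∃ b, time b = t ∧ ω ∈ F b
  · obtain ⟨b, hb, hω⟩ := h
    rw [Finset.sum_eq_single_of_mem b (by simp [hb]), Set.indicator_of_mem hω, add_tsub_eq_max]
    · exact max_le hle (le_supBefore (by omega) hω w)
    · intro b' hb' hne
      have hb't : time b' = t := (Finset.mem_filter.1 hb').2
      exact Set.indicator_of_notMem
        (fun h' => Set.disjoint_left.1 (hF b' b hne (hb't.trans hb.symm)) h' hω) _
  · push Not at h
    rw [Finset.sum_eq_zero, add_zero]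
    · exact hle
    · intro b hb
      exact Set.indicator_of_notMem (h b (Finset.mem_filter.1 hb).2) _

end

theorem measurable_supBefore {Ω Ω' : Type*} [MeasurableSpace Ω] [MeasurableSpace Ω']
    {F : β → Set Ω} (hF : ∀ b, MeasurableSet (F b)) {f : Ω' → Ω} (hf : Measurable f)
    {w : Ω' → β → ℝ≥0∞} (hw : ∀ b, Measurable fun p => w p b) (t : ℕ) :
    Measurable fun p => supBefore time F t (f p) (w p) := by
  simp only [supBefore, Finset.sup_univ_eq_iSup]
  refine Measurable.iSup fun b => ?_
  split_ifs
  · exact (hw b).indicator (hf (hF b))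
  · exact measurable_const

/-- If membership in `E b` depends only on the coordinates before the time of `b`, then the
coordinate `b` may be exchanged with that of an independent copy. -/
theorem lintegral_indicator_exchange (hE : ∀ b, MeasurableSet (E b))
    (hadapt : ∀ b ω ω', (∀ c, time c < time b → ω c = ω' c) → (ω ∈ E b ↔ ω' ∈ E b))
    (hy : ∀ b, Measurable (y b)) (b : β) :
    ∫⁻ p : (β → X) × (β → X), (E b).indicator (fun _ => y b (p.1 b) - supBefore time E (time b)
        p.1 ((fun c => y c (p.1 c)) ⊔ fun c => y c (p.2 c))) p.1
        ∂(Measure.pi μ).prod (Measure.pi μ) =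
    ∫⁻ p : (β → X) × (β → X), (E b).indicator (fun _ => y b (p.2 b) - supBefore time E (time b)
        p.1 ((fun c => y c (p.1 c)) ⊔ fun c => y c (p.2 c))) p.1
        ∂(Measure.pi μ).prod (Measure.pi μ) := by
  classical
  set Z : (β → X) × (β → X) → ℝ≥0∞ := fun p => supBefore time E (time b)
        p.1 ((fun c => y c (p.1 c)) ⊔ fun c => y c (p.2 c)) with hZ
  have hy1 : ∀ c, Measurable fun p : (β → X) × (β → X) => y c (p.1 c) := fun c =>
    (hy c).comp ((measurable_pi_apply c).comp measurable_fst)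
  have hy2 : ∀ c, Measurable fun p : (β → X) × (β → X) => y c (p.2 c) := fun c =>
    (hy c).comp ((measurable_pi_apply c).comp measurable_snd)
  have hZm : Measurable Z := measurable_supBefore hE measurable_fst
    (fun c => (hy1 c).sup (hy2 c)) _
  have hm1 : Measurable fun p : (β → X) × (β → X) =>
      (E b).indicator (fun _ => y b (p.1 b) - Z p) p.1 :=
    ((hy1 b).sub hZm).indicator (measurable_fst (hE b))
  have hm2 : Measurable fun p : (β → X) × (β → X) =>
      (E b).indicator (fun _ => y b (p.2 b) - Z p) p.1 :=
    ((hy2 b).sub hZm).indicator (measurable_fst (hE b))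
  -- The running maximum uses only times strictly before that of b, and so does membership in `E b`.
  -- Resampling coordinate b in either copy therefore changes neither.
  have hupd : ∀ (ω : β → X) v c, time c < time b → update ω b v c = ω c := by
    intro ω v c hc
    exact update_of_ne (by rintro rfl; exact lt_irrefl _ hc) _ _
  have hEu : ∀ ω v c, time c ≤ time b → (update ω b v ∈ E c ↔ ω ∈ E c) := fun ω v c hc =>
    hadapt c _ _ fun d hd => hupd ω v d (hd.trans_le hc)
  have hZ1 : ∀ ω ω' v, Z (update ω b v, ω') = Z (ω, ω') := fun ω ω' v =>
    supBefore_congr (fun c hc => hEu ω v c hc.le) fun c hc => by simp [hupd ω v c hc]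
  have hZ2 : ∀ ω ω' v, Z (ω, update ω' b v) = Z (ω, ω') := fun ω ω' v =>
    supBefore_congr (fun c hc => Iff.rfl) fun c hc => by simp [hupd ω' v c hc]
  have hind : ∀ ω v (a : ℝ≥0∞), (E b).indicator (fun _ => a) (update ω b v) =
      (E b).indicator (fun _ => a) ω := by
    intro ω v a
    by_cases h : ω ∈ E b
    · rw [Set.indicator_of_mem h, Set.indicator_of_mem ((hEu ω v b le_rfl).2 h)]
    · rw [Set.indicator_of_notMem h, Set.indicator_of_notMem (mt (hEu ω v b le_rfl).1 h)]
  have hm3 : Measurable fun q : ((β → X) × (β → X)) × X =>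
      (E b).indicator (fun _ => y b q.2 - Z q.1) q.1.1 :=
    (((hy b).comp measurable_snd).sub (hZm.comp measurable_fst)).indicator
      ((measurable_fst.comp measurable_fst) (hE b))
  have hm4 : Measurable fun p : (β → X) × (β → X) =>
      ∫⁻ v, (E b).indicator (fun _ => y b v - Z p) p.1 ∂μ b := hm3.lintegral_prod_right'
  -- Both sides equal the integral with a fresh sample v in place of coordinate b.
  trans ∫⁻ p : (β → X) × (β → X), ∫⁻ v, (E b).indicator (fun _ => y b v - Z p) p.1 ∂μ b
    ∂(Measure.pi μ).prod (Measure.pi μ)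
  · rw [lintegral_prod_symm' _ hm1, lintegral_prod_symm' _ hm4]
    refine lintegral_congr fun ω' => ?_
    rw [lintegral_pi_eq_lintegral_update b
      (f := fun ω => (E b).indicator (fun _ => y b (ω b) - Z (ω, ω')) ω)
      (hm1.comp measurable_prodMk_right)]
    simp only [hZ1, hind, update_self]
  · rw [lintegral_prod _ hm2.aemeasurable, lintegral_prod _ hm4.aemeasurable]
    refine lintegral_congr fun ω => ?_
    symm
    rw [lintegral_pi_eq_lintegral_update b
      (f := fun ω' => (E b).indicator (fun _ => y b (ω' b) - Z (ω, ω')) ω)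
      (hm2.comp measurable_prodMk_left)]
    simp only [hZ2, update_self]

/-- Induction on time, comparing the increments of the two running maxima. The selection is always
read off the first copy. -/
theorem lintegral_supBefore_le (hE : ∀ b, MeasurableSet (E b))
    (hadapt : ∀ b ω ω', (∀ c, time c < time b → ω c = ω' c) → (ω ∈ E b ↔ ω' ∈ E b))
    (hdisj : ∀ b b', b ≠ b' → time b = time b' → Disjoint (E b) (E b'))
    (hy : ∀ b, Measurable (y b)) (t : ℕ) :
    ∫⁻ p : (β → X) × (β → X), supBefore time E t
        p.1 ((fun c => y c (p.1 c)) ⊔ fun c => y c (p.2 c))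
        ∂(Measure.pi μ).prod (Measure.pi μ) ≤
    2 * ∫⁻ p : (β → X) × (β → X), supBefore time E t p.1 (fun c => y c (p.2 c))
        ∂(Measure.pi μ).prod (Measure.pi μ) := by
  have hy1 : ∀ c, Measurable fun p : (β → X) × (β → X) => y c (p.1 c) := fun c =>
    (hy c).comp ((measurable_pi_apply c).comp measurable_fst)
  have hy2 : ∀ c, Measurable fun p : (β → X) × (β → X) => y c (p.2 c) := fun c =>
    (hy c).comp ((measurable_pi_apply c).comp measurable_snd)
  induction t with
  | zero => simp [supBefore]
  | succ t ih =>
    set Z : (β → X) × (β → X) → ℝ≥0∞ := fun p => supBefore time E t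
        p.1 ((fun c => y c (p.1 c)) ⊔ fun c => y c (p.2 c)) with hZ
    set B : (β → X) × (β → X) → ℝ≥0∞ := fun p => supBefore time E t
        p.1 (fun c => y c (p.2 c)) with hB
    have hZm : Measurable Z := measurable_supBefore hE measurable_fst
      (fun c => (hy1 c).sup (hy2 c)) _
    have hBm : Measurable B := measurable_supBefore hE measurable_fst hy2 _
    have hm1 : ∀ b, Measurable fun p : (β → X) × (β → X) =>
        (E b).indicator (fun _ => y b (p.1 b) - Z p) p.1 := fun b =>
      ((hy1 b).sub hZm).indicator (measurable_fst (hE b))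
    have hm2 : ∀ b, Measurable fun p : (β → X) × (β → X) =>
        (E b).indicator (fun _ => y b (p.2 b) - Z p) p.1 := fun b =>
      ((hy2 b).sub hZm).indicator (measurable_fst (hE b))
    have hm3 : ∀ b, Measurable fun p : (β → X) × (β → X) =>
        (E b).indicator (fun _ => y b (p.2 b) - B p) p.1 := fun b =>
      ((hy2 b).sub hBm).indicator (measurable_fst (hE b))
    have hBZ : ∀ p, B p ≤ Z p := fun p => supBefore_mono le_sup_right
    have hZs : ∀ p : (β → X) × (β → X), supBefore time E (t + 1) p.1
        ((fun c => y c (p.1 c)) ⊔ fun c => y c (p.2 c)) ≤ Z p + ∑ b with time b = t,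
          ((E b).indicator (fun _ => y b (p.1 b) - Z p) p.1 +
            (E b).indicator (fun _ => y b (p.2 b) - Z p) p.1) := fun p =>
      supBefore_succ_max_le t p.1 _ _
    have hBs : ∀ p : (β → X) × (β → X), B p + ∑ b with time b = t,
        (E b).indicator (fun _ => y b (p.2 b) - B p) p.1 ≤
          supBefore time E (t + 1) p.1 (fun c => y c (p.2 c)) := fun p =>
      supBefore_add_le_succ hdisj t p.1 _
    refine (lintegral_mono hZs).trans (le_trans ?_ (mul_le_mul_right (lintegral_mono hBs) 2))
    rw [lintegral_add_left hZm, lintegral_add_left hBm,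
      lintegral_finsetSum _ fun b _ => (hm1 b).fun_add (hm2 b),
      lintegral_finsetSum _ fun b _ => hm3 b, mul_add, Finset.mul_sum]
    refine add_le_add ih (Finset.sum_le_sum fun b hb => ?_)
    have hbt : time b = t := (Finset.mem_filter.1 hb).2
    have hex := lintegral_indicator_exchange (μ := μ) hE hadapt hy b
    rw [hbt] at hex
    -- The factor 2 arises here: the excess of the first copy has the same mean as that of the
    -- second.
    rw [lintegral_add_left (hm1 b), hex, ← two_mul]
    refine mul_le_mul_right (lintegral_mono fun p => ?_) 2
    exact Set.indicator_le_indicator (tsub_le_tsub_left (hBZ p) _)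

/-- **Adaptivity gap.** An adaptive selection gains in expectation at most twice as much as the
same random selection does when it is evaluated on an independent copy of the rewards. -/
theorem lintegral_adaptive_sup_le (hE : ∀ b, MeasurableSet (E b))
    (hadapt : ∀ b ω ω', (∀ c, time c < time b → ω c = ω' c) → (ω ∈ E b ↔ ω' ∈ E b))
    (hdisj : ∀ b b', b ≠ b' → time b = time b' → Disjoint (E b) (E b'))
    (hy : ∀ b, Measurable (y b)) {S : (β → X) → Finset β} (hS : ∀ ω b, b ∈ S ω ↔ ω ∈ E b) :
    ∫⁻ ω, (S ω).sup (fun b => y b (ω b)) ∂Measure.pi μ ≤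
      2 * ∫⁻ ω, ∫⁻ ω', (S ω).sup (fun b => y b (ω' b)) ∂Measure.pi μ ∂Measure.pi μ := by
  obtain ⟨t, ht⟩ : ∃ t, ∀ b, time b < t :=
    ⟨Finset.univ.sup time + 1, fun b => Nat.lt_succ_of_le (Finset.le_sup (Finset.mem_univ b))⟩
  have hsup : ∀ ω w, supBefore time E t ω w = (S ω).sup w := by
    intro ω w
    refine le_antisymm (supBefore_le fun b _ hω => Finset.le_sup ((hS ω b).2 hω))
      (Finset.sup_le fun b hb => le_supBefore (ht b) ((hS ω b).1 hb) w)
  have hy1 : ∀ c, Measurable fun p : (β → X) × (β → X) => y c (p.1 c) := fun c =>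
    (hy c).comp ((measurable_pi_apply c).comp measurable_fst)
  have hy2 : ∀ c, Measurable fun p : (β → X) × (β → X) => y c (p.2 c) := fun c =>
    (hy c).comp ((measurable_pi_apply c).comp measurable_snd)
  have h := lintegral_supBefore_le (μ := μ) hE hadapt hdisj hy t
  rw [lintegral_prod _ (measurable_supBefore hE measurable_fst hy2 t).aemeasurable] at h
  simp only [hsup] at h
  refine le_trans ?_ h
  calc ∫⁻ ω, (S ω).sup (fun b => y b (ω b)) ∂Measure.pi μ
      = ∫⁻ p : (β → X) × (β → X), supBefore time E t p.1 (fun c => y c (p.1 c))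
          ∂(Measure.pi μ).prod (Measure.pi μ) := by
        rw [lintegral_prod _ (measurable_supBefore hE measurable_fst hy1 t).aemeasurable]
        simp [hsup]
    _ ≤ _ := lintegral_mono fun p => by
        rw [hsup]
        -- The first copy alone is dominated by the maximum of both.
        exact Finset.sup_mono_fun fun b _ => le_sup_left

end AdaptivityGap

/-! ### Finite maxima with value 0 on the empty set. -/

section MaxOrZero

variable {ι : Type*} {s : Finset ι} {f : ι → ℝ} {a : ℝ}

theorem maxOrZero_le (ha : 0 ≤ a) (h : ∀ b ∈ s, f b ≤ a) : maxOrZero s f ≤ a := by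
  unfold maxOrZero
  split_ifs with hs
  · exact Finset.sup'_le hs f h
  · exact ha

theorem le_maxOrZero {b : ι} (hb : b ∈ s) : f b ≤ maxOrZero s f := by
  rw [maxOrZero, dif_pos ⟨b, hb⟩]
  exact Finset.le_sup' f hb

theorem maxOrZero_nonneg (h : ∀ b ∈ s, 0 ≤ f b) : 0 ≤ maxOrZero s f := by
  rcases s.eq_empty_or_nonempty with rfl | ⟨b, hb⟩
  · simp [maxOrZero]
  · exact (h b hb).trans (le_maxOrZero hb)

theorem ofReal_maxOrZero_le :
    ENNReal.ofReal (maxOrZero s f) ≤ s.sup fun b => ENNReal.ofReal (f b) := by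
  unfold maxOrZero
  split_ifs with hs
  · obtain ⟨b, hb, h⟩ := Finset.exists_mem_eq_sup' hs f
    rw [h]
    exact Finset.le_sup (f := fun b => ENNReal.ofReal (f b)) hb
  · simp

theorem measurable_maxOrZero {Ω : Type*} [MeasurableSpace Ω] (s : Finset ι) {f : ι → Ω → ℝ}
    (hf : ∀ b, Measurable (f b)) : Measurable fun ω => maxOrZero s fun b => f b ω := by
  unfold maxOrZero
  split_ifs with hs
  · have h := Finset.measurable_sup' hs fun b _ => hf b
    convert h using 2
    rw [Finset.sup'_apply]
  · exact measurable_const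

end MaxOrZero

/-! ### Reservation values and capped rewards. -/

section CappedReward

theorem cappedReward_coe (ρ : ℝ) (v : ℝ≥0) : cappedReward ρ v = min (v : ℝ) ρ := by
  rw [cappedReward, ← EReal.coe_strictMono.monotone.map_min, EReal.toReal_coe]

theorem cappedReward_top (v : ℝ≥0) : cappedReward ⊤ v = v := by
  simp [cappedReward]

theorem measurable_cappedReward (r : EReal) : Measurable (cappedReward r) :=
  ((measurable_coe_real_ereal.comp measurable_subtype_coe).min measurable_const).ereal_toReal

variable {D : ProbabilityMeasure ℝ≥0} {c : ℝ≥0} {r : EReal}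

theorem IsReservationValue.cappedReward_le (h : IsReservationValue D c r) (v : ℝ≥0) :
    cappedReward r v ≤ v := by
  rcases h with ⟨ρ, rfl, -⟩ | ⟨rfl, -⟩
  · rw [cappedReward_coe]
    exact min_le_left _ _
  · rw [cappedReward_top]

theorem IsReservationValue.integral_sub_cappedReward (h : IsReservationValue D c r) :
    ∫ v : ℝ≥0, ((v : ℝ) - cappedReward r v) ∂(D : Measure ℝ≥0) = c := by
  rcases h with ⟨ρ, rfl, h⟩ | ⟨rfl, rfl⟩
  · rw [← h]
    refine integral_congr_ae (Filter.Eventually.of_forall fun v => ?_)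
    simp only [cappedReward_coe]
    rcases le_total (v : ℝ) ρ with h | h
    · rw [min_eq_left h, max_eq_right (by linarith), sub_self]
    · rw [min_eq_right h, max_eq_left (by linarith)]
  · simp [cappedReward_top]

theorem IsReservationValue.integrable_cappedReward (h : IsReservationValue D c r)
    (hD : Integrable (fun v : ℝ≥0 => (v : ℝ)) (D : Measure ℝ≥0)) :
    Integrable (cappedReward r) (D : Measure ℝ≥0) := by
  rcases h with ⟨ρ, rfl, -⟩ | ⟨rfl, -⟩
  · exact (hD.inf (integrable_const ρ)).congr
      (Filter.Eventually.of_forall fun v => (cappedReward_coe ρ v).symm)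
  · exact hD.congr (Filter.Eventually.of_forall fun v => (cappedReward_top v).symm)

theorem IsReservationValue.cappedReward_nonneg (h : IsReservationValue D c r) (hr : 0 ≤ r)
    (v : ℝ≥0) : 0 ≤ cappedReward r v := by
  rcases h with ⟨ρ, rfl, -⟩ | ⟨rfl, -⟩
  · rw [cappedReward_coe]
    exact le_min v.2 (by exact_mod_cast hr)
  · rw [cappedReward_top]
    exact v.2

theorem IsReservationValue.cappedReward_nonpos (h : IsReservationValue D c r) (hr : ¬ 0 ≤ r)
    (v : ℝ≥0) : cappedReward r v ≤ 0 := by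
  rcases h with ⟨ρ, rfl, -⟩ | ⟨rfl, -⟩
  · rw [cappedReward_coe]
    exact (min_le_right _ _).trans (le_of_lt (by exact_mod_cast not_le.1 hr))
  · simp at hr

end CappedReward

namespace PandoraOverTime

variable {n H : ℕ} {I : PandoraOverTime n H}

instance (I : PandoraOverTime n H) : IsProbabilityMeasure I.realizationLaw := by
  unfold realizationLaw
  infer_instance

theorem integrable_realizationLaw_eval {b : Fin n × Fin H} {f : ℝ≥0 → ℝ}
    (hf : Integrable f (I.rewardLaw b.1 b.2 : Measure ℝ≥0)) :
    Integrable (fun ω : Realization n H => f (ω b)) I.realizationLaw :=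
  (measurePreserving_eval (fun b : Fin n × Fin H => (I.rewardLaw b.1 b.2 : Measure ℝ≥0))
    b).integrable_comp_of_integrable hf

theorem integrable_prod_eval {b : Fin n × Fin H} {f : ℝ≥0 → ℝ}
    (hf : Integrable f (I.rewardLaw b.1 b.2 : Measure ℝ≥0)) :
    Integrable (fun q : unitInterval × Realization n H => f (q.2 b))
      ((volume : Measure unitInterval).prod I.realizationLaw) :=
  (measurePreserving_snd (μ := (volume : Measure unitInterval))
    (ν := I.realizationLaw)).integrable_comp_of_integrable (integrable_realizationLaw_eval hf)

/-! ### Values of matchings. -/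

section MatchingValue

variable {r : Fin n → Fin H → EReal}

theorem matchingValue_le_maxMatchingValue {M : Finset (Fin n × Fin H)} (hM : I.IsMatching M) :
    I.matchingValue r M ≤ I.maxMatchingValue r :=
  Finset.le_sup' (I.matchingValue r) (by simpa [matchings] using hM)

theorem maxMatchingValue_nonneg : 0 ≤ I.maxMatchingValue r := by
  have h : I.IsMatching ∅ := by simp [isMatching_iff]
  simpa [matchingValue, maxOrZero] using matchingValue_le_maxMatchingValue (r := r) h

/-- Boxes with a negative reservation value may be left out of a matching, so that its value is
at least the expectation of the positive part of the largest capped reward. -/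
theorem lintegral_sup_cappedReward_le
    (hr : ∀ i t, IsReservationValue (I.rewardLaw i t) (I.cost i t) (r i t))
    {M : Finset (Fin n × Fin H)} (hM : I.IsMatching M) :
    ∫⁻ ω, M.sup (fun b => ENNReal.ofReal (cappedReward (r b.1 b.2) (ω b))) ∂I.realizationLaw ≤
      ENNReal.ofReal (I.maxMatchingValue r) := by
  classical
  -- On `M'` all capped rewards are nonnegative, so its value is a lower integral; the discarded
  -- terms contribute 0 to the supremum of the `ENNReal.ofReal` terms.
  set M' := M.filter fun b => 0 ≤ r b.1 b.2 with hM'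
  have hM'match : I.IsMatching M' := by
    rw [isMatching_iff] at hM ⊢
    exact hM.subset fun b hb => (Finset.mem_filter.1 hb).1
  have hnn : ∀ ω : Realization n H, ∀ b ∈ M', 0 ≤ cappedReward (r b.1 b.2) (ω b) := fun ω b hb =>
    (hr b.1 b.2).cappedReward_nonneg (Finset.mem_filter.1 hb).2 _
  have hint : Integrable (fun ω : Realization n H =>
      maxOrZero M' fun b => cappedReward (r b.1 b.2) (ω b)) I.realizationLaw := by
    refine Integrable.mono' (g := fun ω => ∑ b, (ω b : ℝ))
      (integrable_finsetSum _ fun b _ => integrable_realizationLaw_eval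
        (I.integrable_reward b.1 b.2)) (measurable_maxOrZero M' fun b =>
          (measurable_cappedReward _).comp (measurable_pi_apply b)).aestronglyMeasurable
      (Filter.Eventually.of_forall fun ω => ?_)
    rw [Real.norm_of_nonneg (maxOrZero_nonneg (hnn ω))]
    refine maxOrZero_le (Finset.sum_nonneg fun b _ => (ω b).2) fun b _ => ?_
    exact ((hr b.1 b.2).cappedReward_le _).trans
      (Finset.single_le_sum (f := fun b => (ω b : ℝ)) (fun b _ => (ω b).2) (Finset.mem_univ b))
  refine le_trans ?_ (ENNReal.ofReal_le_ofReal (matchingValue_le_maxMatchingValue hM'match))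
  rw [matchingValue, ofReal_integral_eq_lintegral_ofReal hint
    (Filter.Eventually.of_forall fun ω => maxOrZero_nonneg (hnn ω))]
  refine lintegral_mono fun ω => Finset.sup_le fun b hb => ENNReal.ofReal_le_ofReal ?_
  by_cases h : 0 ≤ r b.1 b.2
  · have hb' : b ∈ M' := Finset.mem_filter.2 ⟨hb, h⟩
    exact le_maxOrZero (f := fun b => cappedReward (r b.1 b.2) (ω b)) hb'
  · exact ((hr b.1 b.2).cappedReward_nonpos h _).trans (maxOrZero_nonneg (hnn ω))

end MatchingValue

/-! ### Inspected sets, measurability and integrability. -/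

namespace Strategy

variable (π : I.Strategy)

theorem mem_inspected {u : unitInterval} {ω : Realization n H} {b : Fin n × Fin H} :
    b ∈ π.inspected u ω ↔ π.inspect u ω b.2 = some b.1 := by
  simp [inspected]

/-- The block of an earlier inspection at s ends by s + p_i, and the next inspection is at s + 1 +
p_i or later, so round vertices do not meet. Box vertices differ because no box is inspected twice.
-/
theorem isMatching_inspected (u : unitInterval) (ω : Realization n H) :
    I.IsMatching (π.inspected u ω) := by
  have key : ∀ b ∈ π.inspected u ω, ∀ b' ∈ π.inspected u ω, b.1 ≠ b'.1 → b.2 < b'.2 →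
      Disjoint (I.hyperedge b) (I.hyperedge b') := by
    intro b hb b' hb' hne hlt
    have hp := π.processing u ω b.2 b'.2 b.1 b'.1 (π.mem_inspected.1 hb)
      (π.mem_inspected.1 hb') hlt
    rw [Set.disjoint_left]
    rintro (i | k) h h'
    · simp only [hyperedge, Set.mem_union, Set.mem_singleton_iff, Sum.inl.injEq, Set.mem_image,
        reduceCtorEq, and_false, exists_false, or_false] at h h'
      exact hne (h.symm.trans h')
    · simp [hyperedge] at h h'
      have : (b'.2 : ℕ) ≤ k := h'.1
      omega
  rw [isMatching_iff]
  intro b hb b' hb' hne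
  have h := π.mem_inspected.1 hb
  have h' := π.mem_inspected.1 hb'
  have h2 : b.2 ≠ b'.2 := by
    intro h2
    rw [h2, h'] at h
    exact hne (Prod.ext (Option.some_injective _ h).symm h2)
  have h1 : b.1 ≠ b'.1 := by
    intro h1
    rw [← h1] at h'
    exact h2 (π.inspect_once u ω _ _ _ h h')
  rcases lt_or_gt_of_ne h2 with hlt | hlt
  · exact key b hb b' hb' h1 hlt
  · exact (key b' hb' b hb h1.symm hlt).symm

theorem mem_inspected_congr {u : unitInterval} {b : Fin n × Fin H} {ω ω' : Realization n H}
    (h : ∀ c : Fin n × Fin H, (c.2 : ℕ) < b.2 → ω c = ω' c) :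
    b ∈ π.inspected u ω ↔ b ∈ π.inspected u ω' := by
  rw [mem_inspected, mem_inspected,
    π.inspect_adapted u ω ω' b.2 fun s hs i _ => h (i, s) hs]

theorem measurableSet_mem_inspected (b : Fin n × Fin H) :
    MeasurableSet {q : unitInterval × Realization n H | b ∈ π.inspected q.1 q.2} := by
  simpa only [mem_inspected] using π.measurableSet_inspect b.2 b.1

/-- The inspected set takes finitely many values, each on a measurable event. -/
theorem measurable_comp_inspected {f : Finset (Fin n × Fin H) → unitInterval × Realization n H → ℝ}
    (hf : ∀ S, Measurable (f S)) : Measurable fun q => f (π.inspected q.1 q.2) q := by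
  have h : (fun q => f (π.inspected q.1 q.2) q) =
      fun q => ∑ S, if π.inspected q.1 q.2 = S then f S q else 0 := by
    ext q
    simp
  rw [h]
  refine Finset.measurable_sum _ fun S _ => Measurable.ite ?_ (hf S) measurable_const
  have : {q : unitInterval × Realization n H | π.inspected q.1 q.2 = S} =
      ⋂ b, {q | b ∈ π.inspected q.1 q.2 ↔ b ∈ S} := by
    ext q
    simp [Finset.ext_iff]
  rw [this]
  refine MeasurableSet.iInter fun b => ?_
  by_cases hb : b ∈ S
  · simpa [hb] using π.measurableSet_mem_inspected b
  · simp only [hb, iff_false]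
    exact (π.measurableSet_mem_inspected b).compl

/-- The best capped reward of an inspected box, or `0` if this is larger. -/
noncomputable def cappedUtility (r : Fin n → Fin H → EReal) (q : unitInterval × Realization n H) :
    ℝ :=
  maxOrZero (π.inspected q.1 q.2) fun b => max (cappedReward (r b.1 b.2) (q.2 b)) 0

theorem cappedUtility_nonneg (r : Fin n → Fin H → EReal) (q : unitInterval × Realization n H) :
    0 ≤ π.cappedUtility r q :=
  maxOrZero_nonneg fun _ _ => le_max_right _ _

theorem measurable_cappedUtility (r : Fin n → Fin H → EReal) :
    Measurable (π.cappedUtility r) :=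
  π.measurable_comp_inspected (f := fun S q => maxOrZero S fun b =>
    max (cappedReward (r b.1 b.2) (q.2 b)) 0) fun S => measurable_maxOrZero S fun b =>
    ((measurable_cappedReward _).comp ((measurable_pi_apply b).comp measurable_snd)).max
      measurable_const

/-- The sum of all rewards is an integrable envelope, being a finite sum of variables of finite
mean. -/
theorem integrable_of_le_sum {f : unitInterval × Realization n H → ℝ} (hf : Measurable f)
    (h0 : ∀ q, 0 ≤ f q) (h : ∀ q, f q ≤ ∑ b, (q.2 b : ℝ)) :
    Integrable f ((volume : Measure unitInterval).prod I.realizationLaw) :=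
  Integrable.mono' (integrable_finsetSum _ fun (b : Fin n × Fin H) _ => integrable_prod_eval
    (I.integrable_reward b.1 b.2)) hf.aestronglyMeasurable
    (Filter.Eventually.of_forall fun q => by
      rw [Real.norm_of_nonneg (h0 q)]
      exact h q)

theorem le_sum_reward (q : unitInterval × Realization n H) (b : Fin n × Fin H) :
    (q.2 b : ℝ) ≤ ∑ b, (q.2 b : ℝ) :=
  Finset.single_le_sum (f := fun b => (q.2 b : ℝ)) (fun b _ => (q.2 b).2) (Finset.mem_univ b)

theorem sum_reward_nonneg (q : unitInterval × Realization n H) : 0 ≤ ∑ b, (q.2 b : ℝ) :=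
  Finset.sum_nonneg fun b _ => (q.2 b).2

theorem integrable_maxOrZero_discount :
    Integrable (fun q : unitInterval × Realization n H => maxOrZero (π.inspected q.1 q.2)
      fun b => (I.discount b.1 (q.2 b) (π.halt q.1 q.2 - (b.2 : ℕ)) : ℝ))
      ((volume : Measure unitInterval).prod I.realizationLaw) := by
  refine integrable_of_le_sum ?_ (fun q => maxOrZero_nonneg fun b _ => NNReal.coe_nonneg _)
    fun q => maxOrZero_le (sum_reward_nonneg q) fun b _ => ?_
  · refine π.measurable_comp_inspected (f := fun S q => maxOrZero S fun b =>
      (I.discount b.1 (q.2 b) (π.halt q.1 q.2 - (b.2 : ℕ)) : ℝ)) fun S =>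
      measurable_maxOrZero S fun b => measurable_subtype_coe.comp ?_
    have h : Measurable fun p : ℝ≥0 × ℕ => I.discount b.1 p.1 (p.2 - (b.2 : ℕ)) :=
      measurable_from_prod_countable_left fun k => I.measurable_discount b.1 (k - (b.2 : ℕ))
    exact h.comp (((measurable_pi_apply b).comp measurable_snd).prodMk π.measurable_halt)
  · refine le_trans ?_ (le_sum_reward q b)
    have h := I.discount_le b.1 (q.2 b) (π.halt q.1 q.2 - (b.2 : ℕ))
    rw [I.discount_zero] at h
    exact_mod_cast h

theorem integrable_ite_mem {b : Fin n × Fin H} {f : unitInterval × Realization n H → ℝ}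
    (hf : Integrable f ((volume : Measure unitInterval).prod I.realizationLaw)) :
    Integrable (fun q => if b ∈ π.inspected q.1 q.2 then f q else 0)
      ((volume : Measure unitInterval).prod I.realizationLaw) := by
  refine (hf.indicator (π.measurableSet_mem_inspected b)).congr
    (Filter.Eventually.of_forall fun q => ?_)
  simp [Set.indicator_apply]

theorem integrable_sum_cost :
    Integrable (fun q : unitInterval × Realization n H =>
      ∑ b ∈ π.inspected q.1 q.2, (I.cost b.1 b.2 : ℝ))
      ((volume : Measure unitInterval).prod I.realizationLaw) := by
  have h := integrable_finsetSum Finset.univ fun b _ =>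
    π.integrable_ite_mem (b := b) (integrable_const (I.cost b.1 b.2 : ℝ))
  refine h.congr (Filter.Eventually.of_forall fun q => ?_)
  simp [Finset.sum_ite_mem]

theorem integrable_utility :
    Integrable (I.utility π) ((volume : Measure unitInterval).prod I.realizationLaw) :=
  π.integrable_maxOrZero_discount.sub π.integrable_sum_cost

/-! ### Charging costs to excess rewards, and the bound by matchings. -/

variable {r : Fin n → Fin H → EReal}

/-- Whether `b` is inspected is independent of its reward. -/
theorem lintegral_ite_mem_inspected (b : Fin n × Fin H) {e : ℝ≥0 → ENNReal} (he : Measurable e) :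
    ∫⁻ q, (if b ∈ π.inspected q.1 q.2 then
        ∫⁻ v, e v ∂(I.rewardLaw b.1 b.2 : Measure ℝ≥0) else 0)
      ∂((volume : Measure unitInterval).prod I.realizationLaw) =
    ∫⁻ q, (if b ∈ π.inspected q.1 q.2 then e (q.2 b) else 0)
      ∂((volume : Measure unitInterval).prod I.realizationLaw) := by
  have hS := π.measurableSet_mem_inspected b
  have hm1 : Measurable fun q : unitInterval × Realization n H =>
      if b ∈ π.inspected q.1 q.2 then
        ∫⁻ v, e v ∂(I.rewardLaw b.1 b.2 : Measure ℝ≥0) else 0 :=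
    Measurable.ite hS measurable_const measurable_const
  have hm2 : Measurable fun q : unitInterval × Realization n H =>
      if b ∈ π.inspected q.1 q.2 then e (q.2 b) else 0 :=
    Measurable.ite hS (he.comp ((measurable_pi_apply b).comp measurable_snd)) measurable_const
  rw [lintegral_prod _ hm1.aemeasurable, lintegral_prod _ hm2.aemeasurable]
  refine lintegral_congr fun u => ?_
  have hm3 : Measurable fun ω : Realization n H =>
      if b ∈ π.inspected u ω then e (ω b) else 0 := hm2.comp measurable_prodMk_left
  have hres := lintegral_pi_eq_lintegral_update
    (μ := fun b : Fin n × Fin H => (I.rewardLaw b.1 b.2 : Measure ℝ≥0)) b hm3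
  refine Eq.trans ?_ hres.symm
  refine lintegral_congr fun ω => ?_
  -- Adaptedness looks only at strictly earlier rounds, hence not at the reward of b itself.
  have hmem : ∀ v, b ∈ π.inspected u (Function.update ω b v) ↔ b ∈ π.inspected u ω := fun v =>
    π.mem_inspected_congr fun c hc =>
      Function.update_of_ne (by rintro rfl; exact lt_irrefl _ hc) _ _
  simp only [hmem, Function.update_self]
  split_ifs <;> simp

/-- The inspection cost may be replaced by the excess of the reward over the reservation value. -/
theorem integral_ite_cost
    (hr : ∀ i t, IsReservationValue (I.rewardLaw i t) (I.cost i t) (r i t)) (b : Fin n × Fin H) :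
    ∫ q, (if b ∈ π.inspected q.1 q.2 then (I.cost b.1 b.2 : ℝ) else 0)
      ∂((volume : Measure unitInterval).prod I.realizationLaw) =
    ∫ q, (if b ∈ π.inspected q.1 q.2 then
        (q.2 b : ℝ) - cappedReward (r b.1 b.2) (q.2 b) else 0)
      ∂((volume : Measure unitInterval).prod I.realizationLaw) := by
  have he0 : ∀ v : ℝ≥0, 0 ≤ (v : ℝ) - cappedReward (r b.1 b.2) v := fun v =>
    sub_nonneg.2 ((hr b.1 b.2).cappedReward_le v)
  have hem : Measurable fun v : ℝ≥0 => (v : ℝ) - cappedReward (r b.1 b.2) v :=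
    measurable_subtype_coe.sub (measurable_cappedReward _)
  have hei : Integrable (fun v : ℝ≥0 => (v : ℝ) - cappedReward (r b.1 b.2) v)
      (I.rewardLaw b.1 b.2 : Measure ℝ≥0) :=
    (I.integrable_reward b.1 b.2).sub
      ((hr b.1 b.2).integrable_cappedReward (I.integrable_reward b.1 b.2))
  have hec := ofReal_integral_eq_lintegral_ofReal hei (Filter.Eventually.of_forall he0)
  rw [(hr b.1 b.2).integral_sub_cappedReward] at hec
  have h := π.lintegral_ite_mem_inspected b hem.ennreal_ofReal
  rw [← hec] at h
  have h1 : ∀ q : unitInterval × Realization n H,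
      0 ≤ if b ∈ π.inspected q.1 q.2 then (I.cost b.1 b.2 : ℝ) else 0 := fun q => by
    split_ifs
    exacts [NNReal.coe_nonneg _, le_rfl]
  have h2 : ∀ q : unitInterval × Realization n H, 0 ≤ if b ∈ π.inspected q.1 q.2 then
      (q.2 b : ℝ) - cappedReward (r b.1 b.2) (q.2 b) else 0 := fun q => by
    split_ifs
    exacts [he0 _, le_rfl]
  rw [integral_eq_lintegral_of_nonneg_ae (Filter.Eventually.of_forall h1)
      (π.integrable_ite_mem (integrable_const _)).aestronglyMeasurable,
    integral_eq_lintegral_of_nonneg_ae (Filter.Eventually.of_forall h2)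
      (π.integrable_ite_mem (integrable_prod_eval hei)).aestronglyMeasurable]
  simp only [apply_ite ENNReal.ofReal, ENNReal.ofReal_zero]
  rw [h]

theorem integrable_cappedUtility
    (hr : ∀ i t, IsReservationValue (I.rewardLaw i t) (I.cost i t) (r i t)) :
    Integrable (π.cappedUtility r) ((volume : Measure unitInterval).prod I.realizationLaw) :=
  integrable_of_le_sum (π.measurable_cappedUtility r) (π.cappedUtility_nonneg r) fun q =>
    maxOrZero_le (sum_reward_nonneg q) fun b _ =>
      max_le (((hr b.1 b.2).cappedReward_le _).trans (le_sum_reward q b)) (sum_reward_nonneg q)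

theorem expectedUtility_le_integral_cappedUtility
    (hr : ∀ i t, IsReservationValue (I.rewardLaw i t) (I.cost i t) (r i t)) :
    I.expectedUtility π ≤
      ∫ q, π.cappedUtility r q ∂((volume : Measure unitInterval).prod I.realizationLaw) := by
  have hie : ∀ b ∈ (Finset.univ : Finset (Fin n × Fin H)),
      Integrable (fun q : unitInterval × Realization n H => if b ∈ π.inspected q.1 q.2 then
        (q.2 b : ℝ) - cappedReward (r b.1 b.2) (q.2 b) else 0)
        ((volume : Measure unitInterval).prod I.realizationLaw) := fun b _ =>
    π.integrable_ite_mem (integrable_prod_eval ((I.integrable_reward b.1 b.2).sub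
      ((hr b.1 b.2).integrable_cappedReward (I.integrable_reward b.1 b.2))))
  have hcost : ∫ q, ∑ b ∈ π.inspected q.1 q.2, (I.cost b.1 b.2 : ℝ)
        ∂((volume : Measure unitInterval).prod I.realizationLaw) =
      ∫ q, ∑ b, (if b ∈ π.inspected q.1 q.2 then
        (q.2 b : ℝ) - cappedReward (r b.1 b.2) (q.2 b) else 0)
        ∂((volume : Measure unitInterval).prod I.realizationLaw) := by
    rw [integral_finsetSum _ hie, ← Finset.sum_congr rfl fun b _ => π.integral_ite_cost hr b,
      ← integral_finsetSum _ fun b _ => π.integrable_ite_mem (integrable_const _)]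
    refine integral_congr_ae (Filter.Eventually.of_forall fun q => ?_)
    simp [Finset.sum_ite_mem]
  have hu : I.expectedUtility π = ∫ q, maxOrZero (π.inspected q.1 q.2)
        (fun b => (I.discount b.1 (q.2 b) (π.halt q.1 q.2 - (b.2 : ℕ)) : ℝ))
        ∂((volume : Measure unitInterval).prod I.realizationLaw) -
      ∫ q, ∑ b ∈ π.inspected q.1 q.2, (I.cost b.1 b.2 : ℝ)
        ∂((volume : Measure unitInterval).prod I.realizationLaw) :=
    integral_sub π.integrable_maxOrZero_discount π.integrable_sum_cost
  rw [hu, hcost, sub_le_iff_le_add, ← integral_add (π.integrable_cappedUtility hr)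
    (integrable_finsetSum _ hie)]
  -- After the exchange of costs for excesses the comparison is pointwise: the discounted reward of
  -- b is at most V = Y + (V - Y), with Y below the capped utility and V - Y one term of the
  -- nonnegative sum.
  refine integral_mono π.integrable_maxOrZero_discount
    ((π.integrable_cappedUtility hr).add (integrable_finsetSum _ hie)) fun q => ?_
  have he0 : ∀ b, 0 ≤ if b ∈ π.inspected q.1 q.2 then
      (q.2 b : ℝ) - cappedReward (r b.1 b.2) (q.2 b) else 0 := by
    intro b
    split_ifs
    · exact sub_nonneg.2 ((hr b.1 b.2).cappedReward_le _)
    · exact le_rfl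
  refine maxOrZero_le (add_nonneg (π.cappedUtility_nonneg r q)
    (Finset.sum_nonneg fun b _ => he0 b)) fun b hb => ?_
  have h1 : cappedReward (r b.1 b.2) (q.2 b) ≤ π.cappedUtility r q :=
    (le_max_left _ 0).trans
      (le_maxOrZero (f := fun b => max (cappedReward (r b.1 b.2) (q.2 b)) 0) hb)
  have h2 := Finset.single_le_sum (fun b _ => he0 b) (Finset.mem_univ b)
  rw [if_pos hb] at h2
  have h3 : (I.discount b.1 (q.2 b) (π.halt q.1 q.2 - (b.2 : ℕ)) : ℝ) ≤ q.2 b := by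
    have h := I.discount_le b.1 (q.2 b) (π.halt q.1 q.2 - (b.2 : ℕ))
    rw [I.discount_zero] at h
    exact_mod_cast h
  linarith

theorem integral_cappedUtility_le
    (hr : ∀ i t, IsReservationValue (I.rewardLaw i t) (I.cost i t) (r i t)) :
    ∫ q, π.cappedUtility r q ∂((volume : Measure unitInterval).prod I.realizationLaw) ≤
      2 * I.maxMatchingValue r := by
  have h0 : 0 ≤ I.maxMatchingValue r := maxMatchingValue_nonneg
  rw [← ENNReal.ofReal_le_ofReal_iff (by positivity),
    ofReal_integral_eq_lintegral_ofReal (π.integrable_cappedUtility hr)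
      (Filter.Eventually.of_forall (π.cappedUtility_nonneg r)),
    lintegral_prod _ (π.measurable_cappedUtility r).ennreal_ofReal.aemeasurable]
  have hu : ∀ u, ∫⁻ ω, ENNReal.ofReal (π.cappedUtility r (u, ω)) ∂I.realizationLaw ≤
      ENNReal.ofReal (2 * I.maxMatchingValue r) := by
    intro u
    have hgap := lintegral_adaptive_sup_le
      (μ := fun b : Fin n × Fin H => (I.rewardLaw b.1 b.2 : Measure ℝ≥0))
      (time := fun b => (b.2 : ℕ)) (E := fun b => {ω | b ∈ π.inspected u ω})
      (y := fun b v => ENNReal.ofReal (cappedReward (r b.1 b.2) v)) (S := π.inspected u)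
      (fun b => measurable_prodMk_left (π.measurableSet_mem_inspected b))
      (fun b ω ω' h => π.mem_inspected_congr h)
      (by
        intro b b' hne ht
        rw [Set.disjoint_left]
        intro ω hb hb'
        have h := π.mem_inspected.1 hb
        rw [Fin.ext ht, π.mem_inspected.1 hb'] at h
        exact hne (Prod.ext (Option.some_injective _ h).symm (Fin.ext ht)))
      (fun b => (measurable_cappedReward _).ennreal_ofReal) (fun _ _ => Iff.rfl)
    refine le_trans (lintegral_mono fun ω => ?_) (hgap.trans ?_)
    · refine ofReal_maxOrZero_le.trans (Finset.sup_mono_fun fun b _ => ?_)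
      rw [ENNReal.ofReal_max]
      simp
    -- For each outer ω the inspected set is a fixed matching for the independent inner copy, so the
    -- bound for a single matching applies.
    · rw [ENNReal.ofReal_mul zero_le_two, ENNReal.ofReal_ofNat]
      refine mul_le_mul_right ?_ 2
      refine (lintegral_mono fun ω =>
        lintegral_sup_cappedReward_le hr (π.isMatching_inspected u ω)).trans ?_
      simp
  refine (lintegral_mono hu).trans ?_
  simp

end Strategy

end PandoraOverTime

theorem mainTheorem6 {n H : ℕ} (I : PandoraOverTime n H) (r : Fin n → Fin H → EReal)
    (hr : ∀ i t, IsReservationValue (I.rewardLaw i t) (I.cost i t) (r i t)) :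
    (∀ π : I.Strategy, Integrable (I.utility π)
      ((volume : Measure unitInterval).prod I.realizationLaw)) ∧
    BddAbove (Set.range I.expectedUtility) ∧
    I.optimalUtility ≤ 2 * I.maxMatchingValue r := by
  have h : ∀ π : I.Strategy, I.expectedUtility π ≤ 2 * I.maxMatchingValue r := fun π =>
    (π.expectedUtility_le_integral_cappedUtility hr).trans (π.integral_cappedUtility_le hr)
  refine ⟨fun π => π.integrable_utility, ⟨2 * I.maxMatchingValue r, ?_⟩, ciSup_le h⟩
  rintro _ ⟨π, rfl⟩
  exact h π
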